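/- For $n \ge 0$, the hypercube $Q_n$ is the graph with vertex set $\{0,1\}^n$ in which two vertices are adjacent if and only if they differ in exactly one coordinate. For $m \ge 0$, the $m$-th layer of $Q_n$ is the subgraph of $Q_n$ induced by all vertices with exactly $m$ or $m+1$ coordinates equal to $1$. A graph is called layered if, for some $n$ and $m$, it is isomorphic to a (not necessarily induced) subgraph of the $m$-th layer of $Q_n$. Theorem. For every $k$ there exists a finite graph of girth at least $k$ that is isomorphic to an induced subgraph of some hypercube but is not layered. -/

import Mathlib

/-- The `n`-dimensional hypercube `Q_n`: the vertices are the 0/1-vectors of length `n` (`true`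
stands for `1`), two of them being adjacent iff they differ in exactly one coordinate. -/
def hypercube (n : ℕ) : SimpleGraph (Fin n → Bool) where
  Adj x y := ∃! i, x i ≠ y i
  symm := ⟨by
    rintro x y ⟨i, hi, hu⟩
    exact ⟨i, hi.symm, fun j hj => hu j hj.symm⟩⟩
  loopless := ⟨by
    rintro x ⟨i, hi, -⟩
    exact hi rfl⟩

/-- The number of `1`s in a 0/1-vector. -/
def numOnes {n : ℕ} (x : Fin n → Bool) : ℕ :=
  (Finset.univ.filter fun i => x i = true).card

/-- The `k`-th layer of `Q_n`: the subgraph of `Q_n` induced by all vertices with exactly `k` or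
`k + 1` ones. -/
def hypercubeLayer (n k : ℕ) :
    SimpleGraph {x : Fin n → Bool | numOnes x = k ∨ numOnes x = k + 1} :=
  (hypercube n).induce {x : Fin n → Bool | numOnes x = k ∨ numOnes x = k + 1}

/-- A graph is layered if it is (isomorphic to) a not necessarily induced subgraph of some layer of
some hypercube. -/
def IsLayered {V : Type*} (G : SimpleGraph V) : Prop :=
  ∃ n k : ℕ, G.IsContained (hypercubeLayer n k)

/-! The graph is the subgraph of a hypercube induced by all initial and final segments of the label
vectors of the points of a suitable finite set `X`. Each point `x` carries labels `a i x`, where `i`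
runs over two sides of `m` labels each, in a linear order; a segment is regarded as the set of its
pairs `(i, α)`. Each `x` yields a cycle of length `4 * m`, which adds the labels of `x` to the empty
set one by one and then removes them in the same order.

*Not layered* (`not_isLayered_segmentGraph`). In a layer of a hypercube the number of ones goes up
and down alternately along a walk, so the coordinate that changes in the step `0` of a closed walk
changes back in an odd step (`exists_odd_step`). For odd `t`, the step `t` of the cycle of `x` adds
or removes a label `i` other than the first. Points that differ in the label `i` only have cycles
with a common first edge, and their edges number `t` share an end; so these edges use distinct
coordinates, and for at most one of the points it is the coordinate of the first edge. Hence, if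
every label can be varied freely in more than `4 * m` ways (`IsBranching`), the fraction of the `x`
for which step `t` uses the coordinate of step `0` is less than `1 / (4 * m)`, and some `x` has no
such `t`.

*Large girth* (`le_length_of_isCycle`). A segment that is not full extends at most one other segment
by an entry, and a full one extends exactly two, one on each side. So a cycle reaches its maximal
number of entries at a full segment, and if it is short it consists of excursions between full
segments, on each of which the labels of one side are kept, the two sides alternating. Such
an alternating chain of points is excluded if the labelling is rigid: a label that agrees at both
ends of a short alternating chain is constant along it (`IsRigid`).

*Construction of the labelling* (`exists_labelling`). The coordinates on `(Fin b) ^ (2 * m)` are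
branching. The parity cover adds to each point a vector over `ZMod 2` with a component for every
pair of values of a label of the first and a label of the second side; the second side sees this
vector changed at the pairs of values of the point itself. Each label is refined by the components
that involve it. The cover is still branching, and it is rigid for chains that are longer by one
step (`isRigid_coverLabel`). Iterating gives any rigidity. -/

/-! ### Labelled sets and alternating chains -/

/-- Two points agree on side `s` if all their labels on that side coincide. -/
def SameOn {m : ℕ} {X A : Type} (a : Bool × Fin m → X → A) (s : Bool) (x y : X) : Prop :=
  ∀ q, a (s, q) x = a (s, q) y

/-- The points `g 0, …, g L` form an alternating chain starting on side `s`: consecutive points are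
distinct, and they agree on side `s` and on side `!s` in turn. -/
def IsAlternating {m : ℕ} {X A : Type} (a : Bool × Fin m → X → A) (s : Bool) (g : ℕ → X)
    (L : ℕ) : Prop :=
  ∀ n < L, g n ≠ g (n + 1) ∧ SameOn a (s ^^ n.bodd) (g n) (g (n + 1))

/-- A labelling is rigid up to length `r` if a label which takes the same value at both ends of an
alternating chain of length at most `r` is constant along the chain. -/
def IsRigid {m : ℕ} {X A : Type} (a : Bool × Fin m → X → A) (r : ℕ) : Prop :=
  ∀ s g L, L ≤ r → IsAlternating a s g L → ∀ i, a i (g 0) = a i (g L) →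
    ∀ n < L, a i (g n) = a i (g (n + 1))

/-- The labels jointly separate points. -/
def IsSeparating {m : ℕ} {X A : Type} (a : Bool × Fin m → X → A) : Prop :=
  ∀ x y, (∀ i, a i x = a i y) → x = y

/-- A labelling is `b`-branching if for each `i` there are `b` injections of the set of points that
change the label `i` only, and give `b` different values to it at each point. -/
def IsBranching {m : ℕ} {X A : Type} (a : Bool × Fin m → X → A) (b : ℕ) : Prop :=
  ∀ i, ∃ σ : Fin b → X → X, (∀ c, Function.Injective (σ c)) ∧
    (∀ c x j, j ≠ i → a j (σ c x) = a j x) ∧ ∀ c c' x, a i (σ c x) = a i (σ c' x) → c = c'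

theorem IsSeparating.exists_ne {m : ℕ} {X A : Type} {a : Bool × Fin m → X → A}
    (ha : IsSeparating a) {s : Bool} {x y : X} (hxy : x ≠ y) (h : SameOn a s x y) :
    ∃ q, a (!s, q) x ≠ a (!s, q) y := by
  by_contra! hc
  refine hxy (ha x y ?_)
  rintro ⟨t, q⟩
  by_cases hts : t = s
  · subst hts; exact h q
  · have : t = !s := by cases t <;> cases s <;> simp_all
    subst this; exact hc q

/-! ### The parity cover of a labelling -/

/-- The indicator of the pair of labels of `x`, for each pair of a label on the side `false` and a
label on the side `true`. -/
noncomputable def pairIndicator {m : ℕ} {X A : Type} (a : Bool × Fin m → X → A) (x : X) :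
    Fin m × Fin m → A × A → ZMod 2 :=
  open Classical in fun P => Pi.single (a (false, P.1) x, a (true, P.2) x) 1

/-- The pair formed by the label `(s, q)` and the label `(!s, p)`, with the label on the side
`false` first. -/
def orderedPair {m : ℕ} (s : Bool) (q p : Fin m) : Fin m × Fin m := if s then (p, q) else (q, p)

/-- The parity vector of a point of the cover, as it is seen from side `s`. -/
noncomputable def sideVector {m : ℕ} {X A : Type} (a : Bool × Fin m → X → A) (s : Bool)
    (z : X × (Fin m × Fin m → A × A → ZMod 2)) : Fin m × Fin m → A × A → ZMod 2 :=
  z.2 + if s then pairIndicator a z.1 else 0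

/-- The labelling of the parity cover: the label `(s, q)` is refined by those components of the
parity vector, as seen from side `s`, that belong to the pairs containing `(s, q)`. -/
noncomputable def coverLabel {m : ℕ} {X A : Type} (a : Bool × Fin m → X → A) :
    Bool × Fin m → X × (Fin m × Fin m → A × A → ZMod 2) → A × (Fin m → A × A → ZMod 2) :=
  fun i z => (a i z.1, fun p => sideVector a i.1 z (orderedPair i.1 i.2 p))

section Cover

variable {m : ℕ} {X A : Type} {a : Bool × Fin m → X → A}

theorem sideVector_not (s : Bool) (z : X × (Fin m × Fin m → A × A → ZMod 2)) :
    sideVector a s z = sideVector a (!s) z + pairIndicator a z.1 := by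
  cases s
  · funext P α
    simp [sideVector, add_assoc, CharTwo.add_self_eq_zero]
  · simp [sideVector]

theorem SameOn.fst {s : Bool} {z w : X × (Fin m × Fin m → A × A → ZMod 2)}
    (h : SameOn (coverLabel a) s z w) : SameOn a s z.1 w.1 :=
  fun q => congrArg Prod.fst (h q)

theorem SameOn.sideVector_eq {s : Bool} {z w : X × (Fin m × Fin m → A × A → ZMod 2)}
    (h : SameOn (coverLabel a) s z w) : sideVector a s z = sideVector a s w := by
  funext P
  cases s
  · exact congrFun (congrArg Prod.snd (h P.1)) P.2
  · exact congrFun (congrArg Prod.snd (h P.2)) P.1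

theorem SameOn.fst_ne {s : Bool} {z w : X × (Fin m × Fin m → A × A → ZMod 2)}
    (h : SameOn (coverLabel a) s z w) (hne : z ≠ w) : z.1 ≠ w.1 := by
  intro h1
  have h2 := h.sideVector_eq
  simp only [sideVector, h1, add_left_inj] at h2
  exact hne (Prod.ext h1 h2)

theorem IsAlternating.fst {s : Bool} {g : ℕ → X × (Fin m × Fin m → A × A → ZMod 2)} {L : ℕ}
    (h : IsAlternating (coverLabel a) s g L) : IsAlternating a s (fun n => (g n).1) L :=
  fun n hn => ⟨(h n hn).2.fst_ne (h n hn).1, (h n hn).2.fst⟩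

theorem IsAlternating.shift {s : Bool} {g : ℕ → X} {L : ℕ} (h : IsAlternating a s g L)
    {t L' : ℕ} (ht : t + L' ≤ L) :
    IsAlternating a (s ^^ t.bodd) (fun n => g (t + n)) L' := by
  intro n hn
  have := h (t + n) (by omega)
  rwa [Nat.bodd_add, ← Bool.xor_assoc] at this

theorem isSeparating_coverLabel (ha : IsSeparating a) :
    IsSeparating (coverLabel a) := by
  intro z w h
  by_contra hne
  have h0 : SameOn (coverLabel a) false z w := fun q => h (false, q)
  exact h0.fst_ne hne (ha _ _ fun i => congrArg Prod.fst (h i))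

theorem pairIndicator_orderedPair (x : X) (s : Bool) (q p : Fin m) (α β : A) :
    pairIndicator a x (orderedPair s q p) (if s then (β, α) else (α, β)) =
      open Classical in if a (s, q) x = α ∧ a (!s, p) x = β then 1 else 0 := by
  classical
  cases s <;> simp [pairIndicator, orderedPair, Pi.single_apply, eq_comm, and_comm]

theorem pairIndicator_orderedPair_congr {x y : X} {s : Bool} {q p : Fin m}
    (h₁ : a (s, q) x = a (s, q) y) (h₂ : a (!s, p) x = a (!s, p) y) :
    pairIndicator a x (orderedPair s q p) = pairIndicator a y (orderedPair s q p) := by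
  cases s <;> simp_all [pairIndicator, orderedPair]

/-- Passing to the parity cover makes the labelling rigid for one more step. Let `n` be the first
step of a chain that changes the label `(s, q)`, and let `p` be such that the next step changes the
label `(!s, p)`. The component of the parity vector at the values of these two labels changes in
step `n`. It can only change again in a later step that starts with the same value of `(!s, p)`;
by the rigidity of `a` there is none, so the refined label differs at the two ends of the chain. -/
theorem isRigid_coverLabel (ha : IsSeparating a) (hm : 0 < m) {r : ℕ} (hr : IsRigid a r) :
    IsRigid (coverLabel a) (r + 1) := by
  classical
  rintro s₀ g L hL hg ⟨s, q⟩ hend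
  have hg' := hg.fst
  suffices hconst : ∀ n < L, a (s, q) (g n).1 = a (s, q) (g (n + 1)).1 by
    intro n hn
    obtain hs | hs : (s₀ ^^ n.bodd) = s ∨ (s₀ ^^ n.bodd) = !s := by
      cases (s₀ ^^ n.bodd) <;> cases s <;> simp
    · have := (hg n hn).2
      rw [hs] at this
      exact this q
    · have h2 := (hg n hn).2
      rw [hs] at h2
      refine Prod.ext (hconst n hn) (funext fun p => ?_)
      change sideVector a s (g n) _ = sideVector a s (g (n + 1)) _
      rw [sideVector_not, sideVector_not s (g (n + 1)), h2.sideVector_eq, Pi.add_apply,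
        Pi.add_apply, pairIndicator_orderedPair_congr (hconst n hn) (h2.fst p)]
  by_contra! hex
  obtain ⟨hnL, hne⟩ := Nat.find_spec hex
  have hmin : ∀ t < Nat.find hex, a (s, q) (g t).1 = a (s, q) (g (t + 1)).1 := by
    intro t ht
    by_contra hc
    exact Nat.find_min hex ht ⟨by omega, hc⟩
  set n := Nat.find hex
  have hside : (s₀ ^^ n.bodd) = !s := by
    by_contra hc
    have hs : (s₀ ^^ n.bodd) = s := by
      revert hc; cases (s₀ ^^ n.bodd) <;> cases s <;> simp
    have := (hg' n hnL).2
    rw [hs] at this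
    exact hne (this q)
  -- A label of the other side that changes at the step after `n`.
  obtain ⟨p, hp⟩ : ∃ p, n + 1 < L →
      a (!s, p) (g (n + 1)).1 ≠ a (!s, p) (g (n + 1 + 1)).1 := by
    by_cases hn1 : n + 1 < L
    · obtain ⟨h1, h2⟩ := hg' (n + 1) hn1
      have hs : (s₀ ^^ (n + 1).bodd) = s := by
        rw [Nat.bodd_succ]
        revert hside; cases s₀ <;> cases n.bodd <;> cases s <;> simp
      rw [hs] at h2
      obtain ⟨p, hp⟩ := ha.exists_ne h1 h2
      exact ⟨p, fun _ => hp⟩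
    · exact ⟨⟨0, hm⟩, fun h => absurd h hn1⟩
  set α := a (s, q) (g n).1 with hα
  set β := a (!s, p) (g (n + 1)).1 with hβ
  have hβn : a (!s, p) (g n).1 = β := by
    have := (hg' n hnL).2
    rw [hside] at this
    exact this p
  -- By the rigidity of `a`, the label `β` does not recur in a step that matters.
  have hlate : ∀ t, n + 1 < t → t < L → a (!s, p) (g t).1 ≠ β := by
    intro t ht htL hc
    have hsh := hg'.shift (t := n + 1) (L' := t - (n + 1)) (by omega)
    have := hr _ _ _ (by omega) hsh (!s, p)
      (by simp only [Nat.add_zero]; rw [Nat.add_sub_cancel' ht.le]; exact hc.symm) 0 (by omega)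
    exact hp (by omega) this
  let F : ℕ → ZMod 2 := fun t =>
    sideVector a s (g t) (orderedPair s q p) (if s then (β, α) else (α, β))
  let D : ℕ → ZMod 2 := fun t =>
    pairIndicator a (g t).1 (orderedPair s q p) (if s then (β, α) else (α, β))
  have hD : ∀ t, D t = if a (s, q) (g t).1 = α ∧ a (!s, p) (g t).1 = β then 1 else 0 :=
    fun t => pairIndicator_orderedPair _ _ _ _ _ _
  have hsame : ∀ t < L, (s₀ ^^ t.bodd) = s → F (t + 1) = F t := by
    intro t ht hs
    have := (hg t ht).2
    rw [hs] at this
    simp only [F, this.sideVector_eq]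
  have hflip : ∀ t < L, (s₀ ^^ t.bodd) = !s → F (t + 1) + D (t + 1) = F t + D t := by
    intro t ht hs
    have := (hg t ht).2
    rw [hs] at this
    have h2 := this.sideVector_eq
    have e : ∀ t, F t + D t =
        sideVector a (!s) (g t) (orderedPair s q p) (if s then (β, α) else (α, β)) := by
      intro t
      have := sideVector_not (a := a) (!s) (g t)
      rw [Bool.not_not] at this
      rw [this]
      rfl
    rw [e, e, h2]
  have hcases : ∀ t : ℕ, (s₀ ^^ t.bodd) = s ∨ (s₀ ^^ t.bodd) = !s := by
    intro t; cases (s₀ ^^ t.bodd) <;> cases s <;> simp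
  have h1 : ∀ t ≤ n, F t = F 0 := by
    intro t
    induction t with
    | zero => intro _; rfl
    | succ t ih =>
      intro ht
      rw [← ih (by omega)]
      rcases hcases t with hs | hs
      · exact hsame t (by omega) hs
      · have h2 := (hg' t (by omega)).2
        rw [hs] at h2
        have h3 : D (t + 1) = D t := by
          rw [hD, hD, hmin t (by omega), h2 p]
        have := hflip t (by omega) hs
        rwa [h3, add_left_inj] at this
  have h2 : F (n + 1) = F 0 + 1 := by
    have := hflip n hnL hside
    rw [hD, hD, if_neg (fun h => hne h.1.symm), if_pos ⟨rfl, hβn⟩, add_zero, h1 n le_rfl] at this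
    exact this
  have h3 : ∀ t, n + 1 + t ≤ L → F (n + 1 + t) = F 0 + 1 := by
    intro t
    induction t with
    | zero => intro _; exact h2
    | succ t ih =>
      intro ht
      rw [← ih (by omega), ← Nat.add_assoc]
      rcases hcases (n + 1 + t) with hs | hs
      · exact hsame _ (by omega) hs
      · have ht0 : 0 < t := by
          rcases Nat.eq_zero_or_pos t with rfl | h
          · rw [Nat.add_zero, Nat.bodd_succ] at hs
            revert hs hside; cases s₀ <;> cases n.bodd <;> cases s <;> simp
          · exact h
        have h4 := (hg' _ (show n + 1 + t < L by omega)).2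
        rw [hs] at h4
        have h5 := hlate (n + 1 + t) (by omega) (by omega)
        have h6 : a (!s, p) (g (n + 1 + t + 1)).1 ≠ β := fun h => h5 ((h4 p).trans h)
        have := hflip _ (show n + 1 + t < L by omega) hs
        rwa [hD, hD, if_neg (fun h => h6 h.2), if_neg (fun h => h5 h.2), add_zero,
          add_zero] at this
  have h4 := h3 (L - (n + 1)) (by omega)
  rw [Nat.add_sub_cancel' (by omega)] at h4
  have h5 : F L = F 0 := by
    have := congrFun (congrArg Prod.snd hend) p
    change sideVector a s (g 0) (orderedPair s q p) = sideVector a s (g L) (orderedPair s q p)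
      at this
    simp only [F, this]
  rw [h5] at h4
  simp at h4

theorem isBranching_coverLabel {b : ℕ} (ha : IsBranching a b) :
    IsBranching (coverLabel a) b := by
  rintro ⟨s, q⟩
  obtain ⟨σ, hinj, hfix, hmove⟩ := ha (s, q)
  -- The parity vector is adjusted so that it stays the same when seen from the side `!s`.
  refine ⟨fun c z => (σ c z.1, z.2 + if s then 0 else
    pairIndicator a z.1 + pairIndicator a (σ c z.1)), ?_, ?_, ?_⟩
  · intro c z w h
    simp only [Prod.mk.injEq] at h
    have h1 := hinj c h.1
    rw [h1, add_left_inj] at h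
    exact Prod.ext h1 h.2
  · rintro c z ⟨t, p⟩ hne
    refine Prod.ext (hfix c z.1 _ hne) ?_
    funext p'
    have hother : ∀ P, sideVector a (!s) (σ c z.1, z.2 + if s then 0 else
        pairIndicator a z.1 + pairIndicator a (σ c z.1)) P = sideVector a (!s) z P := by
      intro P
      cases s
      · funext γ
        simp [sideVector, add_assoc, CharTwo.add_self_eq_zero]
      · simp [sideVector]
    change sideVector a t _ (orderedPair t p p') = sideVector a t z (orderedPair t p p')
    by_cases hts : t = s
    · subst hts
      rw [sideVector_not, sideVector_not t z, Pi.add_apply, Pi.add_apply, hother]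
      congr 1
      exact pairIndicator_orderedPair_congr (hfix c z.1 _ hne) (hfix c z.1 _ (by simp))
    · have : t = !s := by revert hts; cases t <;> cases s <;> simp
      subst this
      exact hother _
  · intro c c' z h
    exact hmove c c' z.1 (congrArg Prod.fst h)

end Cover

theorem isSeparating_eval (m b : ℕ) :
    IsSeparating (fun (i : Bool × Fin m) (x : Bool × Fin m → Fin b) => x i) :=
  fun _ _ h => funext h

theorem isBranching_eval (m b : ℕ) :
    IsBranching (fun (i : Bool × Fin m) (x : Bool × Fin m → Fin b) => x i) b := by
  intro i
  refine ⟨fun c x => Function.update x i (x i + c), ?_, ?_, ?_⟩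
  · intro c x y h
    have : NeZero b := ⟨fun h => by subst h; exact c.elim0⟩
    funext j
    by_cases hj : j = i
    · subst hj
      have := congrFun h j
      simpa using this
    · have := congrFun h j
      simpa [Function.update_of_ne hj] using this
  · intro c x j hj
    simp [Function.update_of_ne hj]
  · intro c c' x h
    have : NeZero b := ⟨fun h => by subst h; exact c.elim0⟩
    simpa using h

/-- Starting from the coordinates of `Fin b`-valued vectors, iterated parity covers give finite
branching labellings of any rigidity. -/
theorem exists_labelling {m : ℕ} (hm : 0 < m) {b : ℕ} (hb : 0 < b) (r : ℕ) :
    ∃ (X A : Type) (_ : Finite X) (_ : Nonempty X) (_ : Finite A) (a : Bool × Fin m → X → A),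
      IsSeparating a ∧ IsBranching a b ∧ IsRigid a r := by
  induction r with
  | zero =>
    refine ⟨Bool × Fin m → Fin b, Fin b, inferInstance, ⟨fun _ => ⟨0, hb⟩⟩, inferInstance, _,
      isSeparating_eval m b, isBranching_eval m b, ?_⟩
    intro s g L hL _ _ _ n hn
    omega
  | succ r ih =>
    obtain ⟨X, A, _, _, _, a, h1, h2, h3⟩ := ih
    exact ⟨_, _, inferInstance, inferInstance, inferInstance, coverLabel a,
      isSeparating_coverLabel h1, isBranching_coverLabel h2, isRigid_coverLabel h1 hm h3⟩

/-! ### The graph of initial and final segments -/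

/-- The position of a label in the linear order in which the side `false` precedes the side
`true`. -/
def labelRank {m : ℕ} (i : Bool × Fin m) : ℕ := (if i.1 then m else 0) + i.2

/-- The first `t` labels of `x`, as a partial vector of labels. -/
def initialSegment {m : ℕ} {X A : Type} (a : Bool × Fin m → X → A) (t : ℕ) (x : X) :
    Bool × Fin m → Option A :=
  fun i => if labelRank i < t then some (a i x) else none

/-- The labels of `x` except the first `t`, as a partial vector of labels. -/
def finalSegment {m : ℕ} {X A : Type} (a : Bool × Fin m → X → A) (t : ℕ) (x : X) :
    Bool × Fin m → Option A :=
  fun i => if t ≤ labelRank i then some (a i x) else none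

/-- The partial vectors of labels that are an initial or a final segment of the full vector of
labels of some point. -/
def Segment {m : ℕ} {X A : Type} (a : Bool × Fin m → X → A) : Type :=
  {v : Bool × Fin m → Option A // ∃ x t, v = initialSegment a t x ∨ v = finalSegment a t x}

instance Segment.finite {m : ℕ} {X A : Type} [Finite A] (a : Bool × Fin m → X → A) :
    Finite (Segment a) :=
  Subtype.finite

/-- The partial vector `w` extends the partial vector `v` by one entry, in place `i`. -/
def ExtendsAt {m : ℕ} {A : Type} (i : Bool × Fin m) (v w : Bool × Fin m → Option A) : Prop :=
  v i = none ∧ w i ≠ none ∧ ∀ j, j ≠ i → v j = w j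

/-- The set of entries `(i, α)` of a partial vector, as a vertex of a hypercube. -/
def encodePartial {m n : ℕ} {A : Type} [DecidableEq A] (e : (Bool × Fin m) × A ≃ Fin n)
    (v : Bool × Fin m → Option A) : Fin n → Bool :=
  fun k => decide (v (e.symm k).1 = some (e.symm k).2)

/-- The subgraph of the hypercube induced by the initial and final segments. -/
def segmentGraph {m n : ℕ} {X A : Type} [DecidableEq A] (e : (Bool × Fin m) × A ≃ Fin n)
    (a : Bool × Fin m → X → A) : SimpleGraph (Segment a) :=
  (hypercube n).comap fun v => encodePartial e v.1

section Encode

variable {m n : ℕ} {X A : Type} [DecidableEq A] (e : (Bool × Fin m) × A ≃ Fin n)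

theorem encodePartial_ne_iff (v w : Bool × Fin m → Option A) (i : Bool × Fin m) (α : A) :
    encodePartial e v (e (i, α)) ≠ encodePartial e w (e (i, α)) ↔
      ¬ (v i = some α ↔ w i = some α) := by
  simp [encodePartial]

theorem encodePartial_injective : Function.Injective (encodePartial e) := by
  intro v w h
  have key : ∀ i α, v i = some α ↔ w i = some α := by
    intro i α
    by_contra hc
    exact (encodePartial_ne_iff e v w i α).2 hc (congrFun h _)
  funext i
  exact Option.ext fun α => key i α

theorem hypercube_adj_encodePartial {v w : Bool × Fin m → Option A} :
    (hypercube n).Adj (encodePartial e v) (encodePartial e w) ↔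
      ∃ i, ExtendsAt i v w ∨ ExtendsAt i w v := by
  constructor
  · rintro ⟨k, hk, hu⟩
    obtain ⟨⟨i, α⟩, rfl⟩ := e.surjective k
    have huniq : ∀ j β, ¬ (v j = some β ↔ w j = some β) → j = i ∧ β = α := by
      intro j β h
      have := hu _ ((encodePartial_ne_iff e v w j β).2 h)
      simpa using this
    rw [encodePartial_ne_iff] at hk
    have hrest : ∀ j, j ≠ i → v j = w j := by
      intro j hj
      refine Option.ext fun β => ?_
      by_contra hc
      exact hj (huniq j β hc).1
    refine ⟨i, ?_⟩
    rcases hv : v i with _ | β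
    · refine Or.inl ⟨hv, fun h => ?_, hrest⟩
      simp [hv, h] at hk
    · rcases hw : w i with _ | γ
      · exact Or.inr ⟨hw, by simp [hv], fun j hj => (hrest j hj).symm⟩
      · exfalso
        have hβγ : β ≠ γ := by
          rintro rfl
          simp [hv, hw] at hk
        have h1 := (huniq i β (by simp [hv, hw, hβγ.symm])).2
        have h2 := (huniq i γ (by simp [hv, hw, hβγ])).2
        exact hβγ (h1.trans h2.symm)
  · have key : ∀ {v w : Bool × Fin m → Option A} {i}, ExtendsAt i v w →
        (hypercube n).Adj (encodePartial e v) (encodePartial e w) := by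
      rintro v w i ⟨hv, hw, hr⟩
      obtain ⟨α, hα⟩ := Option.ne_none_iff_exists'.1 hw
      refine ⟨e (i, α), (encodePartial_ne_iff e v w i α).2 (by simp [hv, hα]), ?_⟩
      intro k hk
      obtain ⟨⟨j, β⟩, rfl⟩ := e.surjective k
      have hk := (encodePartial_ne_iff e v w j β).1 hk
      have hj : j = i := by
        by_contra hj
        simp [hr j hj] at hk
      subst hj
      have : β = α := by
        by_contra hβ
        simp [hv, hα, Ne.symm hβ] at hk
      rw [this]
    rintro ⟨i, h | h⟩
    · exact key h
    · exact (key h).symm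

variable {a : Bool × Fin m → X → A}

theorem segmentGraph_adj {v w : Segment a} :
    (segmentGraph e a).Adj v w ↔ ∃ i, ExtendsAt i v.1 w.1 ∨ ExtendsAt i w.1 v.1 :=
  hypercube_adj_encodePartial e

theorem segmentGraph_isIndContained : (segmentGraph e a).IsIndContained (hypercube n) :=
  ⟨SimpleGraph.Embedding.comap
    ⟨fun v : Segment a => encodePartial e v.1,
      (encodePartial_injective e).comp Subtype.val_injective⟩ _⟩

end Encode

section Rank

variable {m : ℕ}

theorem labelRank_injective : Function.Injective (labelRank (m := m)) := by
  rintro ⟨s, p⟩ ⟨t, q⟩ h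
  have hp := p.2
  have hq := q.2
  cases s <;> cases t <;> simp [labelRank] at h <;> (try simp) <;> omega

theorem labelRank_lt (i : Bool × Fin m) : labelRank i < 2 * m := by
  have := i.2.2
  unfold labelRank
  split <;> omega

theorem exists_labelRank_eq {t : ℕ} (ht : t < 2 * m) : ∃ i : Bool × Fin m, labelRank i = t := by
  by_cases h : t < m
  · exact ⟨(false, ⟨t, h⟩), by simp [labelRank]⟩
  · exact ⟨(true, ⟨t - m, by omega⟩), by simp [labelRank]; omega⟩

theorem labelRank_false_lt (q : Fin m) : labelRank (false, q) < m := by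
  simp [labelRank]

theorem le_labelRank_true (q : Fin m) : m ≤ labelRank (true, q) := by
  simp [labelRank]

end Rank

section Segments

variable {m : ℕ} {X A : Type} {a : Bool × Fin m → X → A}

theorem extendsAt_initialSegment {t : ℕ} {i : Bool × Fin m} (hi : labelRank i = t) (x : X) :
    ExtendsAt i (initialSegment a t x) (initialSegment a (t + 1) x) := by
  refine ⟨by simp [initialSegment, hi], by simp [initialSegment, hi], fun j hj => ?_⟩
  have : labelRank j ≠ t := fun h => hj (labelRank_injective (h.trans hi.symm))
  have h2 : labelRank j < t + 1 ↔ labelRank j < t := by omega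
  simp [initialSegment, h2]

theorem extendsAt_finalSegment {t : ℕ} {i : Bool × Fin m} (hi : labelRank i = t) (x : X) :
    ExtendsAt i (finalSegment a (t + 1) x) (finalSegment a t x) := by
  refine ⟨by simp [finalSegment, hi], by simp [finalSegment, hi], fun j hj => ?_⟩
  have : labelRank j ≠ t := fun h => hj (labelRank_injective (h.trans hi.symm))
  have h2 : t + 1 ≤ labelRank j ↔ t ≤ labelRank j := by omega
  simp [finalSegment, h2]

/-- The full vector of labels of `x`, a vertex of the graph of segments. -/
def fullSegment (a : Bool × Fin m → X → A) (x : X) : Segment a :=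
  ⟨fun i => some (a i x), x, 0, Or.inr (by funext i; simp [finalSegment])⟩

theorem exists_eq_fullSegment {v : Segment a} (hv : ∀ i, v.1 i ≠ none) :
    ∃ x, v = fullSegment a x := by
  obtain ⟨v, x, t, rfl | rfl⟩ := v
  · refine ⟨x, Subtype.ext (funext fun i => ?_)⟩
    have := hv i
    simp only [initialSegment] at this ⊢
    split_ifs at this ⊢ with h
    · rfl
    · exact absurd rfl this
  · refine ⟨x, Subtype.ext (funext fun i => ?_)⟩
    have := hv i
    simp only [finalSegment] at this ⊢
    split_ifs at this ⊢ with h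
    · rfl
    · exact absurd rfl this

/-- A partial vector is defined on the side `s`. -/
def DefinedOn {A : Type} (s : Bool) (v : Bool × Fin m → Option A) : Prop :=
  ∀ q, v (s, q) ≠ none

/-- The number of entries of a partial vector. -/
noncomputable def numEntries {A : Type} (v : Bool × Fin m → Option A) : ℕ :=
  {i | v i ≠ none}.ncard

theorem ExtendsAt.numEntries {v w : Bool × Fin m → Option A} {i : Bool × Fin m}
    (h : ExtendsAt i v w) : numEntries w = numEntries v + 1 := by
  obtain ⟨hv, hw, hr⟩ := h
  have : {j | w j ≠ none} = insert i {j | v j ≠ none} := by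
    ext j
    by_cases hj : j = i
    · subst hj; simpa using hw
    · simp [hr j hj, hj]
  unfold _root_.numEntries
  rw [this, Set.ncard_insert_of_notMem (by simp [hv]) (Set.toFinite _)]

theorem numEntries_le {v : Bool × Fin m → Option A} {N : ℕ}
    (f : ℕ → ℕ) (hf : ∀ i, v i ≠ none → f (labelRank i) < N)
    (hinj : ∀ i j, v i ≠ none → v j ≠ none → f (labelRank i) = f (labelRank j) → i = j) :
    numEntries v ≤ N := by
  have h := Set.ncard_le_ncard_of_injOn (s := {i | v i ≠ none}) (t := Set.Iio N)
    (fun i => f (labelRank i)) (fun i hi => hf i hi)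
    (fun i hi j hj h => hinj i j hi hj h) (Set.finite_Iio N)
  simpa [numEntries] using h

theorem ExtendsAt.fst_eq {i : Bool × Fin m} {v w : Bool × Fin m → Option A} {s : Bool}
    (h : ExtendsAt i v w) (hw : ∀ l, w l ≠ none) (hv : ¬ DefinedOn s v) : i.1 = s := by
  by_contra hc
  refine hv fun q => ?_
  rw [h.2.2 (s, q) (by rintro rfl; exact hc rfl)]
  exact hw _

theorem ExtendsAt.definedOn {i : Bool × Fin m} {v w : Bool × Fin m → Option A} {s : Bool}
    (h : ExtendsAt i v w) (hw : ∀ l, w l ≠ none) (hs : i.1 ≠ s) : DefinedOn s v := by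
  intro q
  rw [h.2.2 (s, q) (by rintro rfl; exact hs rfl)]
  exact hw _

theorem ExtendsAt.not_definedOn {i : Bool × Fin m} {v w : Bool × Fin m → Option A}
    (h : ExtendsAt i v w) : ¬ DefinedOn i.1 v := fun hc => hc i.2 h.1

/-- A segment with more than `m` of the `2 * m` entries contains one of the two sides. -/
theorem definedOn_of_lt_numEntries (v : Segment a) (hv : m < numEntries v.1) :
    ∃ s, DefinedOn s v.1 := by
  obtain ⟨v, x, t, rfl | rfl⟩ := v
  · refine ⟨false, fun q => ?_⟩
    have ht : m ≤ t := by
      by_contra hc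
      have := numEntries_le (v := initialSegment a t x) (N := t) id
        (fun i hi => by simpa [initialSegment] using hi)
        (fun i j _ _ h => labelRank_injective h)
      simp only at hv
      omega
    have := labelRank_false_lt q
    simp [initialSegment, show labelRank (false, q) < t by omega]
  · refine ⟨true, fun q => ?_⟩
    have ht : t ≤ m := by
      by_contra hc
      have hdef : ∀ i, finalSegment a t x i ≠ none → t ≤ labelRank i := fun i hi => by
        simpa [finalSegment] using hi
      have := numEntries_le (v := finalSegment a t x) (N := 2 * m - t) (fun r => r - t)
        (fun i hi => by
          have := hdef i hi
          have := labelRank_lt i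
          omega)
        (fun i j hi hj h => labelRank_injective (by
          have := hdef i hi
          have := hdef j hj
          omega))
      simp only at hv
      omega
    have := le_labelRank_true q
    simp [finalSegment, show t ≤ labelRank (true, q) by omega]

/-- A segment that is not full extends at most one other segment by one entry. -/
theorem eq_of_extendsAt_of_not_full {u v w : Segment a} {i j : Bool × Fin m}
    (hu : ExtendsAt i u.1 w.1) (hv : ExtendsAt j v.1 w.1) (hw : ∃ l, w.1 l = none) : u = v := by
  -- The removed entry is the last one of an initial segment, or the first one of a final segment.
  have key : (∀ (u : Segment a) i, ExtendsAt i u.1 w.1 → ∀ l, w.1 l ≠ none →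
        labelRank l ≤ labelRank i) ∨
      (∀ (u : Segment a) i, ExtendsAt i u.1 w.1 → ∀ l, w.1 l ≠ none →
        labelRank i ≤ labelRank l) := by
    obtain ⟨k, hk⟩ := hw
    obtain ⟨w, x, t, rfl | rfl⟩ := w
    · left
      rintro ⟨u, y, t', rfl | rfl⟩ i ⟨h1, h2, h3⟩ l hl <;> by_contra! hc
      · have h4 := h3 l (by rintro rfl; exact absurd hc (lt_irrefl _))
        simp only [initialSegment] at h4 h1 h2 hl hk
        grind
      · have h4 := h3 l (by rintro rfl; exact absurd hc (lt_irrefl _))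
        have h5 := h3 k (by rintro rfl; exact h2 hk)
        simp only [initialSegment, finalSegment] at h4 h5 h1 h2 hl hk
        grind
    · right
      rintro ⟨u, y, t', rfl | rfl⟩ i ⟨h1, h2, h3⟩ l hl <;> by_contra! hc
      · have h4 := h3 l (by rintro rfl; exact absurd hc (lt_irrefl _))
        have h5 := h3 k (by rintro rfl; exact h2 hk)
        simp only [initialSegment, finalSegment] at h4 h5 h1 h2 hl hk
        grind
      · have h4 := h3 l (by rintro rfl; exact absurd hc (lt_irrefl _))
        simp only [finalSegment] at h4 h1 h2 hl hk
        grind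
  have hij : i = j := by
    refine labelRank_injective (le_antisymm ?_ ?_)
    · rcases key with h | h
      · exact h v j hv i hu.2.1
      · exact h u i hu j hv.2.1
    · rcases key with h | h
      · exact h u i hu j hv.2.1
      · exact h v j hv i hu.2.1
  subst hij
  refine Subtype.ext (funext fun l => ?_)
  by_cases hl : l = i
  · subst hl; rw [hu.1, hv.1]
  · rw [hu.2.2 l hl, hv.2.2 l hl]

/-- A full segment extends one segment that misses an entry on each side. -/
theorem eq_of_extendsAt_of_full {u v w : Segment a} {i j : Bool × Fin m}
    (hu : ExtendsAt i u.1 w.1) (hv : ExtendsAt j v.1 w.1) (hw : ∀ l, w.1 l ≠ none)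
    (hij : i.1 = j.1) : u = v := by
  have key : ∀ (u : Segment a) i, ExtendsAt i u.1 w.1 →
      labelRank i = if i.1 then 2 * m - 1 else 0 := by
    rintro ⟨u, y, t, rfl | rfl⟩ ⟨s, q⟩ ⟨h1, h2, h3⟩
    · obtain ⟨l, hl⟩ := exists_labelRank_eq (m := m) (t := 2 * m - 1) (by have := q.2; omega)
      have hil : (s, q) = l := by
        by_contra hc
        have h4 := h3 l (Ne.symm hc)
        have h5 := hw l
        have h6 := labelRank_lt (s, q)
        simp only [initialSegment] at h1 h4
        grind
      rw [hil, hl]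
      have := q.2
      cases s
      · have := labelRank_false_lt q
        rw [hil, hl] at this
        simp [← hil]
        omega
      · simp [← hil]
    · obtain ⟨l, hl⟩ := exists_labelRank_eq (m := m) (t := 0) (by have := q.2; omega)
      have hil : (s, q) = l := by
        by_contra hc
        have h4 := h3 l (Ne.symm hc)
        have h5 := hw l
        simp only [finalSegment] at h1 h4
        grind
      rw [hil, hl]
      have := q.2
      cases s
      · simp [← hil]
      · have := le_labelRank_true q
        rw [hil, hl] at this
        simp [← hil]
        omega
  have : i = j := labelRank_injective (by rw [key u i hu, key v j hv, hij])
  subst this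
  refine Subtype.ext (funext fun l => ?_)
  by_cases hl : l = i
  · subst hl; rw [hu.1, hv.1]
  · rw [hu.2.2 l hl, hv.2.2 l hl]

end Segments

/-! ### Short cycles -/

section Girth

variable {m n : ℕ} {X A : Type} [DecidableEq A] {e : (Bool × Fin m) × A ≃ Fin n}
  {a : Bool × Fin m → X → A}

theorem numEntries_le_add_length {u v : Segment a} (p : (segmentGraph e a).Walk u v)
    {w : Segment a} (hw : w ∈ p.support) : numEntries u.1 ≤ numEntries w.1 + p.length := by
  induction p with
  | nil => simp_all
  | cons h p ih =>
    rw [SimpleGraph.Walk.support_cons, List.mem_cons] at hw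
    rcases hw with rfl | hw
    · omega
    · have := ih hw
      rw [SimpleGraph.Walk.length_cons]
      obtain ⟨i, hi | hi⟩ := (segmentGraph_adj e).1 h <;> have := hi.numEntries <;> omega

theorem exists_extendsAt_fullSegment {u : Segment a} {x : X}
    (h : (segmentGraph e a).Adj u (fullSegment a x)) :
    ∃ i, ExtendsAt i u.1 (fullSegment a x).1 := by
  obtain ⟨i, hi | hi⟩ := (segmentGraph_adj e).1 h
  · exact ⟨i, hi⟩
  · exact absurd hi.1 (by simp [fullSegment])

/-- A path between two segments that are not full, all of whose vertices contain one of the two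
sides, visits full segments that form an alternating chain: from one such visit to the next the
path keeps all the labels of one side, and it changes sides at each visit. The point `x` is a
fictitious first visit. -/
theorem exists_isAlternating_of_isPath (N : ℕ) {u v : Segment a}
    (p : (segmentGraph e a).Walk u v) (hN : p.length ≤ N) (hp : p.IsPath)
    (hdef : ∀ w ∈ p.support, ∃ s, DefinedOn s w.1) {t : Bool} (hv : DefinedOn t v.1)
    (hv' : ¬ DefinedOn (!t) v.1) {s : Bool} (hu : DefinedOn s u.1) (hu' : ¬ DefinedOn (!s) u.1)
    {x : X} (hx : fullSegment a x ∉ p.support) (hux : ∀ q, u.1 (s, q) = some (a (s, q) x)) :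
    ∃ L g, L ≤ p.length ∧ g 0 = x ∧ IsAlternating a s g L ∧
      (∀ q, v.1 (t, q) = some (a (t, q) (g L))) ∧ (s ≠ t → 0 < L) := by
  induction N generalizing u s x with
  | zero =>
    cases p with
    | nil =>
      have hst : s = t := by
        by_contra hc
        have : t = !s := by revert hc; cases s <;> cases t <;> simp
        exact hu' (this ▸ hv)
      subst hst
      exact ⟨0, fun _ => x, le_rfl, rfl, fun n hn => absurd hn (Nat.not_lt_zero n), hux,
        fun h => absurd rfl h⟩
    | cons h p => simp at hN
  | succ N ih =>
    cases p with
    | nil =>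
      exact ih SimpleGraph.Walk.nil (by simp) hp hdef hu hu' hx hux
    | @cons _ u₁ _ h p =>
      rw [SimpleGraph.Walk.cons_isPath_iff] at hp
      simp only [SimpleGraph.Walk.support_cons, List.mem_cons, not_or] at hx hdef
      simp only [SimpleGraph.Walk.length_cons] at hN ⊢
      by_cases hfull : ∀ i, u₁.1 i ≠ none
      · obtain ⟨y, rfl⟩ := exists_eq_fullSegment hfull
        cases p with
        | nil => exact absurd (fun q => hfull _) hv'
        | @cons _ u₂ _ h' p =>
          obtain ⟨hp, hp2⟩ := hp
          rw [SimpleGraph.Walk.cons_isPath_iff] at hp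
          simp only [SimpleGraph.Walk.support_cons, List.mem_cons, not_or] at hx hdef hp2
          simp only [SimpleGraph.Walk.length_cons] at hN ⊢
          obtain ⟨i, hi⟩ := exists_extendsAt_fullSegment h
          obtain ⟨j, hj⟩ := exists_extendsAt_fullSegment h'.symm
          have his := hi.fst_eq hfull hu'
          have hjs : j.1 = s := by
            by_contra hc
            have hij : i.1 = j.1 := by
              rw [his]; revert hc; cases j.1 <;> cases s <;> simp
            have : u = u₂ := eq_of_extendsAt_of_full hi hj hfull hij
            exact hp2.2 (this ▸ SimpleGraph.Walk.start_mem_support p)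
          obtain ⟨L, g, hL, hg0, hg, hgL, -⟩ := ih p (by omega) hp.1
            (fun w hw => hdef w (Or.inr (Or.inr hw))) (s := !s) (x := y)
            (hj.definedOn hfull (by rw [hjs]; simp))
            (by rw [Bool.not_not, ← hjs]; exact hj.not_definedOn) hp.2
            (fun q => by rw [hj.2.2 _ (by rintro rfl; simp at hjs)]; rfl)
          refine ⟨L + 1, fun n => n.casesOn x g, by omega, rfl, ?_, hgL, fun _ => by omega⟩
          rintro (_ | n) hn
          · change x ≠ g 0 ∧ SameOn a (s ^^ false) x (g 0)
            rw [hg0, Bool.xor_false]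
            refine ⟨?_, fun q => ?_⟩
            · rintro rfl
              exact hx.2.1 rfl
            · have h1 := hux q
              rw [hi.2.2 _ (by rintro rfl; simp at his)] at h1
              exact (Option.some_injective _ h1).symm
          · change g n ≠ g (n + 1) ∧ SameOn a (s ^^ (n + 1).bodd) (g n) (g (n + 1))
            have := hg n (by omega)
            rwa [show ((!s) ^^ n.bodd) = (s ^^ (n + 1).bodd) by
              rw [Nat.bodd_succ]; cases s <;> cases n.bodd <;> rfl] at this
      · push Not at hfull
        have hmissing : ¬ (DefinedOn s u₁.1 ∧ DefinedOn (!s) u₁.1) := by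
          rintro ⟨h1, h2⟩
          obtain ⟨⟨r, q⟩, hl⟩ := hfull
          obtain rfl | rfl : r = s ∨ r = !s := by cases r <;> cases s <;> simp
          · exact h1 q hl
          · exact h2 q hl
        obtain ⟨i, hi⟩ := (segmentGraph_adj e).1 h
        have hrest : ∀ j, j ≠ i → u.1 j = u₁.1 j := by
          intro j hj
          rcases hi with hi | hi
          · exact hi.2.2 j hj
          · exact (hi.2.2 j hj).symm
        -- One step cannot complete one side and remove an entry of the other.
        have hu₁ : DefinedOn s u₁.1 := by
          obtain ⟨r, hr⟩ := hdef u₁ (Or.inr (SimpleGraph.Walk.start_mem_support p))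
          obtain rfl | rfl : r = s ∨ r = !s := by cases r <;> cases s <;> simp
          · exact hr
          · have hi1 : i.1 = !s := by
              by_contra hc
              refine hu' fun q => ?_
              rw [hrest _ (by rintro rfl; exact hc rfl)]
              exact hr q
            intro q
            rw [← hrest _ (by rintro rfl; simp at hi1)]
            exact hu q
        have hu₁' : ¬ DefinedOn (!s) u₁.1 := fun hc => hmissing ⟨hu₁, hc⟩
        have hlabel : ∀ q, u₁.1 (s, q) = some (a (s, q) x) := by
          intro q
          have hne : (s, q) ≠ i := by
            rintro rfl
            rcases hi with hi | hi
            · exact hu q hi.1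
            · exact hu₁ q hi.1
          rw [← hrest _ hne]
          exact hux q
        obtain ⟨L, g, hL, h1⟩ := ih p (by omega) hp.1 (fun w hw => hdef w (Or.inr hw)) hu₁ hu₁'
          hx.2 hlabel
        exact ⟨L, g, by omega, h1⟩

theorem le_length_of_isCycle (ha : IsSeparating a) {k : ℕ} (hr : IsRigid a k) (hk : k < m)
    {u : Segment a} (c : (segmentGraph e a).Walk u u) (hc : c.IsCycle) : k ≤ c.length := by
  classical
  by_contra! hlt
  obtain ⟨w, hw, hmax⟩ := c.support.toFinset.exists_max_image
    (fun v : Segment a => numEntries v.1) ⟨u, by simp⟩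
  simp only [List.mem_toFinset] at hw hmax
  have hc' := (SimpleGraph.Walk.isCycle_rotate hw).2 hc
  have hlen : (c.rotate w hw).length < k := by simpa using hlt
  have hmax' : ∀ v ∈ (c.rotate w hw).support, numEntries v.1 ≤ numEntries w.1 := by
    intro v hv
    exact hmax v ((SimpleGraph.Walk.mem_support_rotate_iff c w hw).1 hv)
  generalize c.rotate w hw = d at hc' hlen hmax'
  have hne := hc'.snd_ne_penultimate
  have hnil : ¬ d.Nil := hc'.not_nil
  have hlower : ∀ v ∈ d.support, (segmentGraph e a).Adj v w → ∃ i, ExtendsAt i v.1 w.1 := by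
    intro v hv h
    obtain ⟨i, hi | hi⟩ := (segmentGraph_adj e).1 h
    · exact ⟨i, hi⟩
    · have := hi.numEntries
      have := hmax' v hv
      omega
  obtain ⟨i, hi⟩ := hlower d.snd (SimpleGraph.Walk.getVert_mem_support _ _) (d.adj_snd hnil).symm
  obtain ⟨j, hj⟩ := hlower d.penultimate (SimpleGraph.Walk.getVert_mem_support _ _)
    (d.adj_penultimate hnil)
  have hfull : ∀ l, w.1 l ≠ none := by
    by_contra! hc
    exact hne (eq_of_extendsAt_of_not_full hi hj hc)
  obtain ⟨x, rfl⟩ := exists_eq_fullSegment hfull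
  have hij : j.1 = !i.1 := by
    by_contra hc
    refine hne (eq_of_extendsAt_of_full hi hj hfull ?_)
    revert hc; cases i.1 <;> cases j.1 <;> simp
  have hnum : numEntries (fullSegment a x).1 = 2 * m := by
    have : {i | (fullSegment a x).1 i ≠ none} = Set.univ := by
      ext; simp [fullSegment]
    rw [numEntries, this, Set.ncard_univ, Nat.card_eq_fintype_card]
    simp
  have hdef : ∀ v ∈ d.support, ∃ s, DefinedOn s v.1 := by
    intro v hv
    refine definedOn_of_lt_numEntries v ?_
    have := numEntries_le_add_length d hv
    omega
  cases d with
  | nil => exact hnil .nil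
  | cons h p =>
    have hpnil : ¬ p.Nil := by
      intro hc
      have h1 := hc.eq
      subst h1
      exact (segmentGraph e a).loopless.irrefl _ h
    rw [SimpleGraph.Walk.penultimate_cons_of_not_nil _ _ hpnil] at hj hne
    rw [SimpleGraph.Walk.snd_cons] at hi hne
    have hp := ((SimpleGraph.Walk.cons_isCycle_iff p h).1 hc').1
    have hsupp := SimpleGraph.Walk.support_dropLast_concat hpnil
    have hnodup := hp.support_nodup
    rw [← hsupp] at hnodup
    have hx : fullSegment a x ∉ p.dropLast.support := by
      intro hx
      simp [List.nodup_append] at hnodup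
      exact hnodup.2 _ hx rfl
    simp only [SimpleGraph.Walk.support_cons, List.mem_cons, SimpleGraph.Walk.length_cons]
      at hdef hlen
    have hlen' := SimpleGraph.Walk.length_dropLast_add_one hpnil
    have key : ∀ q, ∀ s, s ≠ i.1 → (s, q) ≠ i := by
      rintro q s hs rfl
      exact hs rfl
    have key' : ∀ q, ∀ s, s ≠ j.1 → (s, q) ≠ j := by
      rintro q s hs rfl
      exact hs rfl
    obtain ⟨L, g, hL, hg0, hg, hgL, hpos⟩ := exists_isAlternating_of_isPath (e := e) _ p.dropLast
      le_rfl hp.dropLast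
      (fun v hv => hdef v (Or.inr (by rw [← hsupp]; simp [hv])))
      (t := i.1) (s := !i.1) (x := x)
      (hj.definedOn hfull (by rw [hij]; simp)) (hij ▸ hj.not_definedOn)
      (hi.definedOn hfull (by simp)) (by rw [Bool.not_not]; exact hi.not_definedOn) hx
      (fun q => by rw [hi.2.2 _ (key q _ (by simp))]; rfl)
    have hLpos := hpos (by simp)
    have h0 := hg 0 hLpos
    have hsame : ∀ q, a (i.1, q) (g 0) = a (i.1, q) (g L) := by
      intro q
      have h1 := hgL q
      rw [hj.2.2 _ (key' q _ (by rw [hij]; simp))] at h1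
      rw [hg0]
      exact Option.some_injective _ h1
    obtain ⟨q, hq⟩ := ha.exists_ne h0.1 h0.2
    have hq' := hr _ _ _ (by omega) hg (i.1, q) (hsame q) 0 hLpos
    simp only [Nat.bodd_zero, Bool.xor_false, Bool.not_not] at hq
    exact hq hq'

end Girth

/-! ### Closed walks in a layer -/

section Layer

variable {n : ℕ}

theorem eq_of_hypercube_adj {y z z' : Fin n → Bool} (h : (hypercube n).Adj y z)
    (h' : (hypercube n).Adj y z') {k : Fin n} (hk : y k ≠ z k) (hk' : y k ≠ z' k) : z = z' := by
  funext j
  by_cases hj : j = k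
  · subst hj
    revert hk hk'
    cases y j <;> cases z j <;> cases z' j <;> simp
  · have h1 : y j = z j := by
      by_contra hc
      exact hj (h.unique hc hk)
    have h2 : y j = z' j := by
      by_contra hc
      exact hj (h'.unique hc hk')
    rw [← h1, h2]

theorem numOnes_eq_add_one {y z : Fin n → Bool} (h : (hypercube n).Adj y z) {k : Fin n}
    (hy : y k = false) (hz : z k = true) : numOnes z = numOnes y + 1 := by
  have : (Finset.univ.filter fun i => z i = true) =
      insert k (Finset.univ.filter fun i => y i = true) := by
    ext j
    by_cases hj : j = k
    · subst hj; simp [hz]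
    · have : y j = z j := by
        by_contra hc
        exact hj (h.unique hc (by simp [hy, hz]))
      simp [this, hj]
  rw [numOnes, this, Finset.card_insert_of_notMem (by simp [hy]), numOnes]

theorem numOnes_ne {y z : Fin n → Bool} (h : (hypercube n).Adj y z) : numOnes y ≠ numOnes z := by
  obtain ⟨k, hk, -⟩ := id h
  rcases hy : y k <;> rcases hz : z k
  · simp [hy, hz] at hk
  · have := numOnes_eq_add_one h hy hz; omega
  · have := numOnes_eq_add_one h.symm hz hy; omega
  · simp [hy, hz] at hk

/-- Along a closed walk in a layer, the coordinate that changes in the first step changes back in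
a step with an odd number, the first step having number `0`: the number of ones goes up and down
alternately. -/
theorem exists_odd_step {l N : ℕ} (y : ℕ → Fin n → Bool)
    (hlayer : ∀ t, numOnes (y t) = l ∨ numOnes (y t) = l + 1)
    (hadj : ∀ t < N, (hypercube n).Adj (y t) (y (t + 1))) (hN : 0 < N) (hclosed : y N = y 0)
    {k : Fin n} (hk : y 0 k ≠ y 1 k) : ∃ t < N, Odd t ∧ y t k ≠ y (t + 1) k := by
  by_contra! hc
  have hne : ∀ t < N, numOnes (y t) ≠ numOnes (y (t + 1)) := fun t ht => numOnes_ne (hadj t ht)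
  have hpar : ∀ t ≤ N, numOnes (y t) = if Even t then numOnes (y 0) else numOnes (y 1) := by
    intro t
    induction t with
    | zero => simp
    | succ t ih =>
      intro ht
      have h1 := ih (by omega)
      have h2 := hne t (by omega)
      have h3 := hne 0 hN
      rw [zero_add] at h3
      have := hlayer t
      have := hlayer (t + 1)
      have := hlayer 0
      have := hlayer 1
      by_cases he : Even t
      · simp only [he, if_true, Nat.even_add_one, not_true_eq_false, if_false] at h1 ⊢
        omega
      · simp only [he, if_false, Nat.even_add_one, not_false_eq_true, if_true] at h1 ⊢
        omega
  have hconst : ∀ t, t + 1 ≤ N → y (t + 1) k = y 1 k := by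
    intro t
    induction t with
    | zero => intro _; rfl
    | succ t ih =>
      intro ht
      have h1 := ih (by omega)
      rcases Nat.even_or_odd (t + 1) with he | ho
      · by_contra hflip
        have h2 := hpar (t + 1) (by omega)
        have h3 := hpar (t + 1 + 1) ht
        have ho : ¬ Even (t + 1 + 1) := by rw [Nat.even_add_one]; simpa using he
        rw [if_pos he] at h2
        rw [if_neg ho] at h3
        have ha0 : (hypercube n).Adj (y 0) (y 1) := hadj 0 hN
        have ha := hadj (t + 1) (by omega)
        rcases hy1 : y 1 k
        · have hy0 : y 0 k = true := by simpa [hy1] using hk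
          have hyt : y (t + 1 + 1) k = true := by simpa [h1, hy1] using hflip
          have := numOnes_eq_add_one ha0.symm hy1 hy0
          have := numOnes_eq_add_one ha (h1.trans hy1) hyt
          omega
        · have hy0 : y 0 k = false := by simpa [hy1] using hk
          have hyt : y (t + 1 + 1) k = false := by simpa [h1, hy1] using hflip
          have := numOnes_eq_add_one ha0 hy0 hy1
          have := numOnes_eq_add_one ha.symm hyt (h1.trans hy1)
          omega
      · rw [← hc (t + 1) (by omega) ho, h1]
  have := hconst (N - 1) (by omega)
  rw [Nat.sub_add_cancel hN, hclosed] at this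
  exact hk this

end Layer

/-! ### The cycle through a full segment -/

/-- The closed walk of length `4 * m` that adds the labels of `x` one by one and then removes them
in the same order. -/
def around {m : ℕ} {X A : Type} (a : Bool × Fin m → X → A) (x : X) (t : ℕ) : Segment a :=
  if t ≤ 2 * m then ⟨initialSegment a t x, x, t, Or.inl rfl⟩
  else ⟨finalSegment a (t - 2 * m) x, x, t - 2 * m, Or.inr rfl⟩

section Around

variable {m : ℕ} {X A : Type} {a : Bool × Fin m → X → A}

theorem around_of_le {t : ℕ} (ht : t ≤ 2 * m) (x : X) :
    (around a x t).1 = initialSegment a t x := by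
  simp [around, ht]

theorem around_of_ge {t : ℕ} (ht : 2 * m ≤ t) (x : X) :
    (around a x t).1 = finalSegment a (t - 2 * m) x := by
  rcases ht.eq_or_lt with rfl | ht
  · funext i
    simp [around, initialSegment, finalSegment, labelRank_lt i]
  · simp [around, show ¬ t ≤ 2 * m by omega]

theorem around_closed (x : X) : around a x (4 * m) = around a x 0 := by
  refine Subtype.ext ?_
  rw [around_of_ge (by omega), around_of_le (by omega)]
  funext i
  have := labelRank_lt i
  simp [initialSegment, finalSegment, show ¬ 4 * m - 2 * m ≤ labelRank i by omega]

theorem around_adj [DecidableEq A] {n : ℕ} (e : (Bool × Fin m) × A ≃ Fin n) (x : X) {t : ℕ}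
    (ht : t < 4 * m) : (segmentGraph e a).Adj (around a x t) (around a x (t + 1)) := by
  rw [segmentGraph_adj]
  by_cases h : t < 2 * m
  · obtain ⟨i, hi⟩ := exists_labelRank_eq h
    refine ⟨i, Or.inl ?_⟩
    rw [around_of_le (by omega), around_of_le (by omega)]
    exact extendsAt_initialSegment hi x
  · obtain ⟨i, hi⟩ := exists_labelRank_eq (m := m) (t := t - 2 * m) (by omega)
    refine ⟨i, Or.inr ?_⟩
    rw [around_of_ge (by omega), around_of_ge (by omega),
      show t + 1 - 2 * m = t - 2 * m + 1 by omega]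
    exact extendsAt_finalSegment hi x

theorem initialSegment_congr {x y : X} {i : Bool × Fin m} (h : ∀ j, j ≠ i → a j x = a j y) {t : ℕ}
    (ht : t ≤ labelRank i) : initialSegment a t x = initialSegment a t y := by
  funext j
  simp only [initialSegment]
  split_ifs with hj
  · rw [h j (by rintro rfl; omega)]
  · rfl

theorem finalSegment_congr {x y : X} {i : Bool × Fin m} (h : ∀ j, j ≠ i → a j x = a j y) {t : ℕ}
    (ht : labelRank i < t) : finalSegment a t x = finalSegment a t y := by
  funext j
  simp only [finalSegment]
  split_ifs with hj
  · rw [h j (by rintro rfl; omega)]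
  · rfl

theorem not_isAcyclic_segmentGraph [DecidableEq A] {n : ℕ} (e : (Bool × Fin m) × A ≃ Fin n)
    (hm : 0 < m) (x : X) : ¬ (segmentGraph e a).IsAcyclic := by
  intro hac
  rw [SimpleGraph.isAcyclic_iff_forall_adj_isBridge] at hac
  have hb := hac (around_adj e x (t := 0) (by omega))
  rw [SimpleGraph.isBridge_iff] at hb
  refine hb ?_
  -- The rest of the closed walk avoids its first edge.
  obtain ⟨i, hi⟩ := exists_labelRank_eq (m := m) (t := 0) (by omega)
  obtain ⟨j, hj⟩ := exists_labelRank_eq (m := m) (t := 2 * m - 1) (by omega)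
  have hne : ∀ t, 1 ≤ t → t < 4 * m → around a x t ≠ around a x 0 := by
    intro t h1 h2 hc
    have hc := congrArg Subtype.val hc
    rw [around_of_le (t := 0) (by omega)] at hc
    by_cases ht : t ≤ 2 * m
    · rw [around_of_le ht] at hc
      have := congrFun hc i
      simp [initialSegment, hi] at this
      omega
    · rw [around_of_ge (by omega)] at hc
      have := congrFun hc j
      simp [initialSegment, finalSegment, hj] at this
      omega
  have hlast : around a x (4 * m - 1) ≠ around a x 1 := by
    intro hc
    have hc := congrArg Subtype.val hc
    rw [around_of_le (t := 1) (by omega), around_of_ge (by omega)] at hc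
    have := congrFun hc i
    simp [initialSegment, finalSegment, hi] at this
    omega
  have hreach : ∀ t, 1 + t ≤ 4 * m →
      ((segmentGraph e a).deleteEdges {s(around a x 0, around a x 1)}).Reachable
        (around a x 1) (around a x (1 + t)) := by
    intro t
    induction t with
    | zero => intro _; exact SimpleGraph.Reachable.refl _
    | succ t ih =>
      intro ht
      refine (ih (by omega)).trans (SimpleGraph.Adj.reachable ?_)
      rw [SimpleGraph.deleteEdges_adj]
      refine ⟨around_adj e x (by omega), fun hc => ?_⟩
      rw [Set.mem_singleton_iff, Sym2.eq_iff] at hc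
      rcases hc with ⟨h1, -⟩ | ⟨h1, h2⟩
      · exact hne _ (by omega) (by omega) h1
      · by_cases hlt : 1 + t + 1 < 4 * m
        · exact hne _ (by omega) hlt h2
        · rw [show 1 + t = 4 * m - 1 by omega] at h1
          exact hlast h1
  have := hreach (4 * m - 1) (by omega)
  rw [show 1 + (4 * m - 1) = 4 * m by omega, around_closed] at this
  exact this.symm

end Around

theorem card_mul_le_of_injective {X : Type} [Finite X] {b : ℕ} (σ : Fin b → X → X)
    (hσ : ∀ c, Function.Injective (σ c)) (T : Set X)
    (hT : ∀ x c c', σ c x ∈ T → σ c' x ∈ T → c = c') : b * T.ncard ≤ Nat.card X := by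
  let τ : Fin b → X ≃ X := fun c => Equiv.ofBijective (σ c) (Finite.injective_iff_bijective.1 (hσ c))
  have hinj : Function.Injective fun p : Fin b × T => (τ p.1).symm p.2.1 := by
    rintro ⟨c, y⟩ ⟨c', y'⟩ h
    simp only at h
    have h1 : σ c ((τ c).symm y) = y := (τ c).apply_symm_apply y
    have h2 : σ c' ((τ c').symm y') = y' := (τ c').apply_symm_apply y'
    have hcc : c = c' := hT ((τ c).symm y) c c' (h1.symm ▸ y.2) (by rw [h, h2]; exact y'.2)
    subst hcc
    have := (τ c).symm.injective h
    rw [Subtype.ext this]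
  have := Nat.card_le_card_of_injective _ hinj
  rwa [Nat.card_prod, Nat.card_eq_fintype_card, Fintype.card_fin, Nat.card_coe_set_eq] at this

/-- If the labelling branches sufficiently, then the graph of segments is not layered. -/
theorem not_isLayered_segmentGraph {m n : ℕ} {X A : Type} [Finite X] [Nonempty X] [DecidableEq A]
    {a : Bool × Fin m → X → A} (e : (Bool × Fin m) × A ≃ Fin n) (hm : 0 < m)
    (ha : IsBranching a (4 * m + 1)) : ¬ IsLayered (segmentGraph e a) := by
  rintro ⟨N, l, ⟨f⟩⟩
  let y : X → ℕ → Fin N → Bool := fun x t => (f (around a x t)).1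
  have hy : ∀ {x x' t t'}, y x t = y x' t' → (around a x t).1 = (around a x' t').1 := by
    intro x x' t t' h
    exact congrArg Subtype.val (f.injective (Subtype.ext h))
  have hy' : ∀ {x x' t t'}, (around a x t).1 = (around a x' t').1 → y x t = y x' t' := by
    intro x x' t t' h
    simp only [y, Subtype.ext h]
  have hadj : ∀ x, ∀ t < 4 * m, (hypercube N).Adj (y x t) (y x (t + 1)) := by
    intro x t ht
    exact f.toHom.map_adj (around_adj e x ht)
  -- The points whose cycle changes the same coordinate in the steps `0` and `t`.
  let T : ℕ → Set X := fun t => {x | ∃ k, y x 0 k ≠ y x 1 k ∧ y x t k ≠ y x (t + 1) k}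
  have hcover : ∀ x, ∃ t < 4 * m, Odd t ∧ x ∈ T t := by
    intro x
    obtain ⟨k, hk, -⟩ := hadj x 0 (by omega)
    obtain ⟨t, ht, ho, h⟩ := exists_odd_step (y x) (fun t => (f (around a x t)).2) (hadj x)
      (by omega) (by simp only [y, around_closed]) hk
    exact ⟨t, ht, ho, k, hk, h⟩
  -- Among points that differ in the label `i` only, at most one belongs to `T t`: their cycles
  -- share the first edge and one end of the edge number `t`, and the edges at that end receive
  -- distinct coordinates.
  have hT : ∀ t < 4 * m, Odd t → (4 * m + 1) * (T t).ncard ≤ Nat.card X := by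
    intro t ht ho
    have hrank : ∃ i : Bool × Fin m,
        (t < 2 * m ∧ labelRank i = t) ∨ (2 * m ≤ t ∧ labelRank i = t - 2 * m) := by
      by_cases h : t < 2 * m
      · obtain ⟨i, hi⟩ := exists_labelRank_eq h
        exact ⟨i, Or.inl ⟨h, hi⟩⟩
      · obtain ⟨i, hi⟩ := exists_labelRank_eq (m := m) (t := t - 2 * m) (by omega)
        exact ⟨i, Or.inr ⟨by omega, hi⟩⟩
    obtain ⟨i, hi⟩ := hrank
    have hpos : 1 ≤ labelRank i := by
      obtain ⟨r, rfl⟩ := ho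
      omega
    obtain ⟨σ, hinj, hfix, hmove⟩ := ha i
    refine card_mul_le_of_injective σ hinj _ ?_
    rintro x c c' ⟨k, hk0, hkt⟩ ⟨k', hk0', hkt'⟩
    refine hmove c c' x ?_
    have hsame : ∀ j, j ≠ i → a j (σ c x) = a j (σ c' x) := fun j hj => by
      rw [hfix c x j hj, hfix c' x j hj]
    have h0 : y (σ c x) 0 = y (σ c' x) 0 := hy' (by
      rw [around_of_le (by omega), around_of_le (by omega)]
      exact initialSegment_congr hsame (by omega))
    have h1 : y (σ c x) 1 = y (σ c' x) 1 := hy' (by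
      rw [around_of_le (by omega), around_of_le (by omega)]
      exact initialSegment_congr hsame hpos)
    rw [h0, h1] at hk0
    have hkk : k = k' := (hadj (σ c' x) 0 (by omega)).unique hk0 hk0'
    subst hkk
    rcases hi with ⟨h, hi⟩ | ⟨h, hi⟩
    · have ht0 : y (σ c x) t = y (σ c' x) t := hy' (by
        rw [around_of_le (by omega), around_of_le (by omega)]
        exact initialSegment_congr hsame hi.ge)
      have := hy (eq_of_hypercube_adj (hadj (σ c x) t ht) (ht0 ▸ hadj (σ c' x) t ht) hkt
        (ht0 ▸ hkt'))
      rw [around_of_le (by omega), around_of_le (by omega)] at this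
      simpa [initialSegment, hi] using congrFun this i
    · have ht0 : y (σ c x) (t + 1) = y (σ c' x) (t + 1) := hy' (by
        rw [around_of_ge (by omega), around_of_ge (by omega)]
        exact finalSegment_congr hsame (by omega))
      have := hy (eq_of_hypercube_adj (hadj (σ c x) t ht).symm
        (ht0 ▸ (hadj (σ c' x) t ht).symm) hkt.symm (ht0 ▸ hkt'.symm))
      rw [around_of_ge (by omega), around_of_ge (by omega)] at this
      simpa [finalSegment, hi] using congrFun this i
  have hunion : Nat.card X ≤ ∑ t ∈ (Finset.range (4 * m)).filter Odd, (T t).ncard := by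
    rw [← Set.ncard_univ]
    refine le_trans (Set.ncard_le_ncard (t := ⋃ t ∈ (Finset.range (4 * m)).filter Odd, T t)
      (fun x _ => ?_) (Set.toFinite _)) (Finset.set_ncard_biUnion_le _ _)
    obtain ⟨t, ht, ho, hx⟩ := hcover x
    simp only [Set.mem_iUnion]
    exact ⟨t, by simp [ht, ho], hx⟩
  have hsum : (4 * m + 1) * ∑ t ∈ (Finset.range (4 * m)).filter Odd, (T t).ncard ≤
      4 * m * Nat.card X := by
    rw [Finset.mul_sum]
    refine (Finset.sum_le_card_nsmul _ _ (Nat.card X) ?_).trans ?_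
    · intro t ht
      simp only [Finset.mem_filter, Finset.mem_range] at ht
      exact hT t ht.1 ht.2
    · rw [smul_eq_mul]
      refine Nat.mul_le_mul_right _ ((Finset.card_filter_le _ _).trans ?_)
      simp
  have hX : 0 < Nat.card X := Nat.card_pos
  have := Nat.mul_le_mul_left (4 * m + 1) hunion
  nlinarith

/-! ### Conclusion -/

/- `SimpleGraph.girth` is `0` on acyclic graphs, so for `k ≥ 1` the first conjunct says that `G` has
a cycle and that every cycle of `G` has length at least `k`. -/
theorem theorem2 (k : ℕ) :
    ∃ (V : Type) (_ : Finite V) (G : SimpleGraph V),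
      k ≤ G.girth ∧ (∃ n : ℕ, G.IsIndContained (hypercube n)) ∧ ¬ IsLayered G := by
  classical
  obtain ⟨X, A, _, _, _, a, hsep, hbranch, hrigid⟩ :=
    exists_labelling (m := k + 1) k.succ_pos (b := 4 * (k + 1) + 1) (Nat.succ_pos _) k
  have e := Finite.equivFin ((Bool × Fin (k + 1)) × A)
  refine ⟨Segment a, inferInstance, segmentGraph e a, ?_, ⟨_, segmentGraph_isIndContained e⟩,
    not_isLayered_segmentGraph e k.succ_pos hbranch⟩
  obtain ⟨x⟩ := ‹Nonempty X›
  obtain ⟨u, c, hc, hg⟩ := SimpleGraph.exists_girth_eq_length.2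
    (not_isAcyclic_segmentGraph e (a := a) k.succ_pos x)
  rw [hg]
  exact le_length_of_isCycle hsep hrigid k.lt_succ_self c hc
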